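/- Let $\Lambda\in\mathbb C^{n\times n}$ be a fixed diagonal matrix whose distinct diagonal entries $\lambda_1,\dots,\lambda_I$ occur with multiplicities $k_1,\dots,k_I\ge 1$, where $k_1+\dots+k_I=n$. Then the similarity class $$\{\,T\Lambda T^{-1} : T\in\mathbb C^{n\times n}\ \text{invertible}\,\}$$ has complex dimension $n^2-\sum_{i=1}^I k_i^2$; that is, it is a nonempty embedded complex submanifold of $\mathbb C^{n\times n}$ of pure complex dimension $n^2-\sum_{i=1}^I k_i^2$. -/

import Mathlib

-- A norm on complex matrices (all norms on this finite-dimensional space are equivalent, so the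
-- choice affects neither the topology nor which maps are holomorphic).
open scoped Matrix.Norms.Operator

/-- `S` is an embedded complex submanifold of pure complex dimension `d` of the finite-dimensional
complex vector space `E`: near each of its points, some biholomorphic map `φ` between open subsets
of `E` carries `S` onto (an open piece of) a `d`-dimensional complex linear subspace. -/
def IsComplexSubmanifoldOfDim {E : Type*} [NormedAddCommGroup E] [NormedSpace ℂ E]
    [FiniteDimensional ℂ E] (S : Set E) (d : ℕ) : Prop :=
  ∀ p ∈ S, ∃ (φ : OpenPartialHomeomorph E E) (W : Submodule ℂ E),
    p ∈ φ.source ∧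
    DifferentiableOn ℂ φ φ.source ∧
    DifferentiableOn ℂ φ.symm φ.target ∧
    Module.finrank ℂ W = d ∧
    φ '' (S ∩ φ.source) = (W : Set E) ∩ φ.target

/-- A set has complex dimension `d` if it is a nonempty embedded complex submanifold of pure
complex dimension `d`. (Nonemptiness makes `d` unique.) -/
def HasComplexDim {E : Type*} [NormedAddCommGroup E] [NormedSpace ℂ E]
    [FiniteDimensional ℂ E] (S : Set E) (d : ℕ) : Prop :=
  S.Nonempty ∧ IsComplexSubmanifoldOfDim S d

/-- The set of all `T * L * T⁻¹` with `T` an invertible complex matrix. -/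
def similarityClass {n : ℕ} (L : Matrix (Fin n) (Fin n) ℂ) : Set (Matrix (Fin n) (Fin n) ℂ) :=
  {A | ∃ T : Matrix (Fin n) (Fin n) ℂ, IsUnit T ∧ A = T * L * T⁻¹}

/-!
Write `D = diagonal v` and split a matrix `Z` as `X + Y`, where `Y` collects the entries `(i, j)`
with `v i = v j` (equivalently, `Y` is the component of `Z` in the commutant of `D`) and `X` the
others. Near the point `T * D * T⁻¹` the similarity class is parametrized by the holomorphic map

  `F Z = (T * (1 + X)) * (D + Y) * (T * (1 + X))⁻¹` (`conjParam`).

Its derivative at `0` is `Z ↦ T * (X * D - D * X + Y) * T⁻¹`, which is injective because the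
`(i, j)` entry of `X * D - D * X` is `(v j - v i) * X i j`. By the inverse function theorem, `F` has
a holomorphic local inverse, and that inverse is the chart, once it is known that for small `Z` the
matrix `F Z` lies in the similarity class exactly when `Y = 0`
(`exists_chart_of_parametrization`).

If `Y = 0`, then `F Z` is a conjugate of `D`. Conversely, let `p` be a separable polynomial with
`p(D) = 0`. If `F Z` is similar to `D`, then so is `D + Y`, hence `p(D + Y) = 0`. As `Y` commutes
with `D`, `p(D + Y) - p(D) = Y * q(Y)`, where `q` is continuous and `q(0) = p'(D)` is invertible;
so `q(Y)` is invertible for small `Y`, and `Y = 0`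
(`Polynomial.eventually_eq_zero_of_aeval_add_eq_zero`).

The chart thus straightens the class to the space of matrices with `Y = 0`, whose dimension is the
number of pairs `(i, j)` with `v i ≠ v j`.
-/

/-! ### Charts from local parametrizations -/

open Filter Topology Polynomial in
/-- A holomorphic map `F` with invertible derivative at `a` that locally pulls `S` back to a linear
subspace `W` straightens `S` near `F a`: its local inverse is the required chart. -/
theorem exists_chart_of_parametrization {E : Type*} [NormedAddCommGroup E] [NormedSpace ℂ E]
    [FiniteDimensional ℂ E] {S : Set E} {F : E → E} {F' : E →L[ℂ] E} {a : E} (W : Submodule ℂ E)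
    (hF : ContDiffAt ℂ 1 F a) (hF' : HasFDerivAt F F' a) (hinj : Function.Injective F')
    (hS : ∀ᶠ z in 𝓝 a, F z ∈ S ↔ z ∈ W) :
    ∃ φ : OpenPartialHomeomorph E E, F a ∈ φ.source ∧ DifferentiableOn ℂ φ φ.source ∧
      DifferentiableOn ℂ φ.symm φ.target ∧ φ '' (S ∩ φ.source) = (W : Set E) ∩ φ.target := by
  have : CompleteSpace E := FiniteDimensional.complete ℂ E
  let L : E ≃L[ℂ] E :=
    (LinearEquiv.ofInjectiveEndo (F' : E →ₗ[ℂ] E) hinj).toContinuousLinearEquiv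
  have hL : HasFDerivAt F (L : E →L[ℂ] E) a := by
    have hLF : (L : E →L[ℂ] E) = F' := by
      ext z
      rfl
    rwa [hLF]
  let e := hF.toOpenPartialHomeomorph F hL one_ne_zero
  have hea : a ∈ e.source := hF.mem_toOpenPartialHomeomorph_source hL one_ne_zero
  have heF : ∀ z, e z = F z := fun z => rfl
  have hsymm : ContDiffAt ℂ 1 e.symm (F a) := hF.to_localInverse hL one_ne_zero
  have h1 : ∀ᶠ z in 𝓝 a, DifferentiableAt ℂ F z :=
    (hF.eventually (by simp)).mono fun z hz => hz.differentiableAt one_ne_zero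
  have h2 : ∀ᶠ z in 𝓝 a, DifferentiableAt ℂ e.symm (F z) :=
    hF.continuousAt.eventually
      ((hsymm.eventually (by simp)).mono fun z hz => hz.differentiableAt one_ne_zero)
  -- Shrink the source until all the local properties hold on it.
  let G : Set E := {z | DifferentiableAt ℂ F z ∧ DifferentiableAt ℂ e.symm (F z) ∧ (F z ∈ S ↔ z ∈ W)}
  have hG : G ∈ 𝓝 a := h1.and (h2.and hS)
  let ψ := e.restr G
  have hψ : ∀ z ∈ ψ.source, z ∈ G := fun z hz => by
    rw [e.restr_source] at hz
    exact interior_subset hz.2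
  have haψ : a ∈ ψ.source := by
    rw [e.restr_source]
    exact ⟨hea, mem_interior_iff_mem_nhds.2 hG⟩
  refine ⟨ψ.symm, ψ.map_source haψ, ?_, ?_, ?_⟩
  · intro y hy
    have hz := ψ.map_target hy
    have h := (hψ _ hz).2.1
    have hy' : F (ψ.symm y) = y := ψ.right_inv hy
    rw [hy'] at h
    exact h.differentiableWithinAt
  · intro z hz
    exact (hψ z hz).1.differentiableWithinAt
  · ext z
    constructor
    · rintro ⟨y, ⟨hyS, hy⟩, rfl⟩
      have hz := ψ.map_target hy
      have hy' : F (ψ.symm y) = y := ψ.right_inv hy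
      exact ⟨(hψ _ hz).2.2.1 (by rwa [hy']), hz⟩
    · rintro ⟨hzW, hz⟩
      exact ⟨F z, ⟨(hψ z hz).2.2.2 hzW, ψ.map_source hz⟩, ψ.left_inv hz⟩

/-! ### Roots of separable polynomials in a Banach algebra -/

open Polynomial in
theorem Polynomial.aeval_units_conj {K R : Type*} [CommRing K] [Ring R] [Algebra K R] (u : Rˣ)
    (a : R) (p : K[X]) :
    aeval (u * a * ↑u⁻¹) p = u * aeval a p * ↑u⁻¹ := by
  induction p using Polynomial.induction_on' with
  | add p q hp hq => simp [hp, hq, mul_add, add_mul]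
  | monomial n c => simp only [aeval_monomial, Units.conj_pow, ← Algebra.smul_def,
      mul_smul_comm, smul_mul_assoc]

open Polynomial in
/-- The difference quotient of a polynomial at `d`, on the elements commuting with `d`: it is
continuous, with value `p'(d)` at `d`. -/
theorem Polynomial.exists_continuous_aeval_sub_eq_mul {K R : Type*} [CommRing K] [Ring R]
    [Algebra K R] [TopologicalSpace R] [IsTopologicalRing R] (d : R) (p : K[X]) :
    ∃ q : R → R, Continuous q ∧ q d = aeval d (derivative p) ∧
      ∀ a, Commute a d → aeval a p - aeval d p = (a - d) * q a := by
  induction p using Polynomial.induction_on' with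
  | add p₁ p₂ h₁ h₂ =>
    obtain ⟨q₁, hc₁, hd₁, hq₁⟩ := h₁
    obtain ⟨q₂, hc₂, hd₂, hq₂⟩ := h₂
    refine ⟨fun a => q₁ a + q₂ a, hc₁.add hc₂, by simp [hd₁, hd₂], fun a ha => ?_⟩
    rw [mul_add, ← hq₁ a ha, ← hq₂ a ha, map_add, map_add]
    abel
  | monomial n c =>
    refine ⟨fun a => algebraMap K R c * ∑ i ∈ Finset.range n, a ^ i * d ^ (n - 1 - i),
      by fun_prop, ?_, fun a ha => ?_⟩
    · have h : ∑ i ∈ Finset.range n, d ^ i * d ^ (n - 1 - i) = n * d ^ (n - 1) := by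
        rw [Finset.sum_congr rfl (g := fun _ => d ^ (n - 1)) fun i hi => ?_]
        · simp
        · rw [← pow_add]
          congr 1
          have := Finset.mem_range.1 hi
          omega
      simp only [h, derivative_monomial, aeval_monomial, map_mul, map_natCast, mul_assoc]
    · rw [aeval_monomial, aeval_monomial, ← mul_sub, ← ha.mul_geom_sum₂, ← mul_assoc, ← mul_assoc,
        Algebra.commutes c (a - d)]

open Filter Topology Polynomial in
/-- A simple root `d` of `p` is isolated among the roots of `p` that commute with `d`. -/
theorem Polynomial.eventually_eq_zero_of_aeval_add_eq_zero {K R : Type*} [CommRing K]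
    [NormedRing R] [HasSummableGeomSeries R] [Algebra K R] {d : R} {p : K[X]}
    (hd : aeval d p = 0) (hu : IsUnit (aeval d (derivative p))) :
    ∀ᶠ y in 𝓝 (0 : R), Commute y d → aeval (d + y) p = 0 → y = 0 := by
  obtain ⟨q, hqc, hqd, hq⟩ := exists_continuous_aeval_sub_eq_mul d p
  have hlim : Tendsto (fun y => q (d + y)) (𝓝 0) (𝓝 (q d)) := by
    have : Continuous fun y => q (d + y) := by fun_prop
    simpa using this.tendsto 0
  have hunit : ∀ᶠ x in 𝓝 (q d), IsUnit x := by
    rw [hqd]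
    exact Units.isOpen.mem_nhds hu
  filter_upwards [hlim.eventually hunit] with y hy hcomm hroot
  have h := hq (d + y) ((Commute.refl d).add_left hcomm)
  rw [hroot, hd, sub_zero, add_sub_cancel_left] at h
  exact hy.mul_left_eq_zero.1 h.symm

/-! ### The parametrization of a conjugacy class -/

/-- The conjugate by `t * (1 + x)` of `d + y`, where `y = P z` and `x = z - P z`. Moving `x` stays
in the conjugacy class of `d`, while moving `y` leaves it. -/
noncomputable def conjParam {R : Type*} [NormedRing R] [NormedAlgebra ℂ R] (d : R) (P : R →L[ℂ] R)
    (t : Rˣ) (z : R) : R :=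
  t * ((1 + (z - P z)) * (d + P z) * Ring.inverse (1 + (z - P z))) * ↑t⁻¹

section

variable {R : Type*} [NormedRing R] [NormedAlgebra ℂ R] (d : R) (P : R →L[ℂ] R) (t : Rˣ)

@[simp]
theorem conjParam_zero : conjParam d P t 0 = t * d * ↑t⁻¹ := by
  simp [conjParam]

theorem contDiffAt_conjParam [HasSummableGeomSeries R] :
    ContDiffAt ℂ 1 (conjParam d P t) 0 := by
  have h : ContDiffAt ℂ 1 (fun z : R => Ring.inverse (1 + (z - P z))) 0 := by
    refine ContDiffAt.comp (g := Ring.inverse) (f := fun z : R => 1 + (z - P z)) (0 : R) ?_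
      (by fun_prop)
    simpa using contDiffAt_ringInverse ℂ (1 : Rˣ)
  unfold conjParam
  fun_prop

/-- The derivative of `conjParam` at `0`: `z ↦ t * (x * d - d * x + y) * t⁻¹`, with `y = P z` and
`x = z - P z`. -/
theorem exists_hasFDerivAt_conjParam [HasSummableGeomSeries R] :
    ∃ F' : R →L[ℂ] R, HasFDerivAt (conjParam d P t) F' 0 ∧
      ∀ z, F' z = t * ((z - P z) * d - d * (z - P z) + P z) * ↑t⁻¹ := by
  have hx : HasFDerivAt (fun z : R => 1 + (z - P z)) (ContinuousLinearMap.id ℂ R - P) 0 :=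
    ((hasFDerivAt_id _).sub P.hasFDerivAt).const_add 1
  have hy : HasFDerivAt (fun z : R => d + P z) P 0 := P.hasFDerivAt.const_add d
  have hi : HasFDerivAt (fun z : R => Ring.inverse (1 + (z - P z)))
      ((-ContinuousLinearMap.mulLeftRight ℂ R ↑(1 : Rˣ)⁻¹ ↑(1 : Rˣ)⁻¹) ∘L
        (ContinuousLinearMap.id ℂ R - P)) 0 := by
    refine HasFDerivAt.comp (g := Ring.inverse) (f := fun z : R => 1 + (z - P z)) (0 : R) ?_ hx
    simpa using hasFDerivAt_ringInverse (𝕜 := ℂ) (1 : Rˣ)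
  refine ⟨_, (((hx.mul' hy).mul' hi).const_mul (t : R)).mul_const' (↑t⁻¹ : R), fun z => ?_⟩
  simp
  noncomm_ring

open Filter Topology Polynomial in
/-- Near `0`, the parametrization meets the conjugacy class of `d` exactly in `ker P`: a conjugate
of `d` is a root of every polynomial having `d` as a root. -/
theorem eventually_conjParam_mem_iff [HasSummableGeomSeries R] {d : R} {P : R →L[ℂ] R} (t : Rˣ)
    {p : ℂ[X]} (hd : aeval d p = 0) (hu : IsUnit (aeval d (derivative p)))
    (hP : ∀ z, Commute (P z) d) :
    ∀ᶠ z in 𝓝 (0 : R), conjParam d P t z ∈ {a | ∃ u : Rˣ, a = u * d * ↑u⁻¹} ↔ P z = 0 := by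
  have h1 : ∀ᶠ z in 𝓝 (0 : R), IsUnit (1 + (z - P z)) := by
    have hc : Continuous fun z : R => 1 + (z - P z) := by fun_prop
    refine (hc.tendsto 0).eventually (Units.isOpen.mem_nhds ?_)
    simp
  have h2 : ∀ᶠ z in 𝓝 (0 : R), Commute (P z) d → aeval (d + P z) p = 0 → P z = 0 := by
    have hc : Tendsto P (𝓝 0) (𝓝 0) := by simpa using P.continuous.tendsto 0
    exact hc.eventually (eventually_eq_zero_of_aeval_add_eq_zero hd hu)
  filter_upwards [h1, h2] with z ⟨s, hs⟩ hz
  have hF : conjParam d P t z = ↑(t * s) * (d + P z) * ↑(t * s)⁻¹ := by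
    rw [conjParam, ← hs, Ring.inverse_unit]
    simp [mul_assoc]
  constructor
  · rintro ⟨u, hu'⟩
    refine hz (hP z) ?_
    have h : aeval (conjParam d P t z) p = 0 := by
      rw [hu', aeval_units_conj, hd]
      simp
    rw [hF, aeval_units_conj, Units.mul_left_eq_zero, Units.mul_right_eq_zero] at h
    exact h
  · intro h
    exact ⟨t * s, by rw [hF, h, add_zero]⟩

end

/-! ### Diagonal matrices -/

namespace Matrix

variable {n : ℕ} (v : Fin n → ℂ)

/-- The projection of a matrix onto its entries `(i, j)` with `v i = v j`, that is, onto the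
commutant of `diagonal v`. -/
noncomputable def commutantProj : Matrix (Fin n) (Fin n) ℂ →L[ℂ] Matrix (Fin n) (Fin n) ℂ :=
  LinearMap.toContinuousLinearMap
    { toFun := fun A => of fun i j => if v i = v j then A i j else 0
      map_add' := fun A B => by ext i j; by_cases h : v i = v j <;> simp [h]
      map_smul' := fun c A => by ext i j; by_cases h : v i = v j <;> simp [h] }

theorem commutantProj_apply (A : Matrix (Fin n) (Fin n) ℂ) (i j : Fin n) :
    commutantProj v A i j = if v i = v j then A i j else 0 := rfl

theorem commute_commutantProj (A : Matrix (Fin n) (Fin n) ℂ) :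
    Commute (commutantProj v A) (diagonal v) := by
  ext i j
  rw [mul_diagonal, diagonal_mul, commutantProj_apply]
  split_ifs with h
  · rw [h, mul_comm]
  · simp

/-- The tangent space to the conjugacy class, the image of `X ↦ [X, diagonal v]`, meets the
commutant of `diagonal v` only in `0`. -/
theorem eq_zero_of_commutator_add_commutantProj_eq_zero {A : Matrix (Fin n) (Fin n) ℂ}
    (h : (A - commutantProj v A) * diagonal v - diagonal v * (A - commutantProj v A)
      + commutantProj v A = 0) : A = 0 := by
  ext i j
  have hij := congrFun (congrFun h i) j
  rw [add_apply, sub_apply, mul_diagonal, diagonal_mul, sub_apply, commutantProj_apply] at hij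
  by_cases hv : v i = v j
  · simpa [hv] using hij
  · have h' : A i j * (v j - v i) = 0 := by
      simp only [hv, if_false, zero_apply] at hij
      linear_combination hij
    simpa [sub_ne_zero.2 (Ne.symm hv)] using h'

open Polynomial in
theorem exists_aeval_diagonal_eq_zero_isUnit_aeval_derivative :
    ∃ p : ℂ[X], aeval (diagonal v) p = 0 ∧ IsUnit (aeval (diagonal v) (derivative p)) := by
  let p : ℂ[X] := ∏ a ∈ Finset.univ.image v, (X - C a)
  have hsep : p.Separable := separable_prod_X_sub_C_iff'.2 fun x _ y _ h => h
  have hdiag : ∀ q : ℂ[X], aeval (diagonal v) q = diagonal fun i => aeval (v i) q := fun q => by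
    have h := aeval_algHom_apply (diagonalAlgHom ℂ) v q
    rw [diagonalAlgHom_apply, diagonalAlgHom_apply] at h
    rw [h]
    congr 1
    ext i
    exact (aeval_algHom_apply (Pi.evalAlgHom ℂ (fun _ : Fin n => ℂ) i) v q).symm
  have hroot : ∀ i, aeval (v i) p = 0 := fun i => by
    rw [map_prod]
    exact Finset.prod_eq_zero (Finset.mem_image_of_mem v (Finset.mem_univ i)) (by simp)
  refine ⟨p, ?_, ?_⟩
  · rw [hdiag]
    simp [hroot]
  · rw [hdiag, isUnit_diagonal, Pi.isUnit_iff]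
    exact fun i => (hsep.aeval_derivative_ne_zero (hroot i)).isUnit

/-- The kernel of `commutantProj` consists of the matrices supported off the pairs `(i, j)` with
`v i = v j`. -/
theorem finrank_ker_commutantProj_add :
    Module.finrank ℂ (commutantProj v).toLinearMap.ker
      + (Finset.univ.filter fun x : Fin n × Fin n => v x.1 = v x.2).card = n ^ 2 := by
  let r : Matrix (Fin n) (Fin n) ℂ →ₗ[ℂ] ({x : Fin n × Fin n // v x.1 = v x.2} → ℂ) :=
    { toFun := fun A x => A x.1.1 x.1.2
      map_add' := fun A B => rfl
      map_smul' := fun c A => rfl }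
  have hr : ∀ A x, r A x = A x.1.1 x.1.2 := fun _ _ => rfl
  have hker : (commutantProj v).toLinearMap.ker = r.ker := by
    ext A
    simp only [LinearMap.mem_ker]
    constructor
    · intro h
      ext ⟨⟨i, j⟩, hij⟩
      have := congrFun (congrFun h i) j
      simpa [hr, commutantProj_apply, show v i = v j from hij] using this
    · intro h
      ext i j
      by_cases hij : v i = v j
      · have := congrFun h ⟨(i, j), hij⟩
        simpa [hr, commutantProj_apply, hij] using this
      · simp [commutantProj_apply, hij]
  have hsurj : r.range = ⊤ := LinearMap.range_eq_top.2 fun f => by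
    refine ⟨of fun i j => if h : v i = v j then f ⟨(i, j), h⟩ else 0, ?_⟩
    ext ⟨⟨i, j⟩, hij⟩
    exact dif_pos hij
  have h := r.finrank_range_add_finrank_ker
  rw [hsurj, finrank_top, Module.finrank_fintype_fun_eq_card, Fintype.card_subtype,
    Module.finrank_matrix, Module.finrank_self, Fintype.card_fin] at h
  rw [hker, add_comm, h]
  ring

end Matrix

theorem hasComplexDim_similarityClass_diagonal {n : ℕ} (v : Fin n → ℂ) :
    HasComplexDim (similarityClass (Matrix.diagonal v)) (Module.finrank ℂ
      (Matrix.commutantProj v).toLinearMap.ker) := by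
  have hS : similarityClass (Matrix.diagonal v) =
      {A | ∃ u : (Matrix (Fin n) (Fin n) ℂ)ˣ, A = u * Matrix.diagonal v * u⁻¹.val} := by
    ext A
    constructor
    · rintro ⟨_, ⟨u, rfl⟩, rfl⟩
      exact ⟨u, by rw [Matrix.coe_units_inv]⟩
    · rintro ⟨u, rfl⟩
      exact ⟨u, u.isUnit, by rw [Matrix.coe_units_inv]⟩
  rw [hS]
  refine ⟨⟨Matrix.diagonal v, 1, by simp⟩, ?_⟩
  rintro _ ⟨t, rfl⟩
  obtain ⟨p, hp, hp'⟩ := Matrix.exists_aeval_diagonal_eq_zero_isUnit_aeval_derivative v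
  obtain ⟨F', hF', hF'_apply⟩ :=
    exists_hasFDerivAt_conjParam (Matrix.diagonal v) (Matrix.commutantProj v) t
  have hinj : Function.Injective F' := by
    rw [injective_iff_map_eq_zero]
    intro A hA
    rw [hF'_apply, Units.mul_left_eq_zero, Units.mul_right_eq_zero] at hA
    exact Matrix.eq_zero_of_commutator_add_commutantProj_eq_zero v hA
  obtain ⟨φ, h0, h1, h2, h3⟩ := exists_chart_of_parametrization
    (Matrix.commutantProj v).toLinearMap.ker
    (contDiffAt_conjParam _ _ t) hF' hinj
    (eventually_conjParam_mem_iff t hp hp' (Matrix.commute_commutantProj v))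
  exact ⟨φ, _, Set.mem_of_eq_of_mem (conjParam_zero _ _ t).symm h0, h1, h2, rfl, h3⟩

/-! ### Counting the pairs of equal diagonal entries -/

theorem Finset.card_filter_eq_eq_sum_sq {ι κ α : Type*} [Fintype ι] [Fintype κ] [DecidableEq α]
    {f : ι → α} {g : κ → α} (hg : Function.Injective g) (hf : ∀ j, ∃ i, f j = g i) :
    (univ.filter fun x : ι × ι => f x.1 = f x.2).card =
      ∑ i, (univ.filter fun j => f j = g i).card ^ 2 := by
  classical
  have h : (univ.filter fun x : ι × ι => f x.1 = f x.2) = univ.biUnion fun i =>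
      (univ.filter fun j => f j = g i) ×ˢ (univ.filter fun j => f j = g i) := by
    ext ⟨a, b⟩
    simp only [mem_filter, mem_univ, true_and, mem_biUnion, mem_product]
    constructor
    · intro hab
      obtain ⟨i, hi⟩ := hf a
      exact ⟨i, hi, hab ▸ hi⟩
    · rintro ⟨i, ha, hb⟩
      exact ha.trans hb.symm
  rw [h, card_biUnion]
  · simp [card_product, sq]
  · intro i _ j _ hij
    rw [Function.onFun, disjoint_left]
    rintro ⟨a, b⟩ ha hb
    simp only [mem_filter, mem_univ, true_and, mem_product] at ha hb
    exact hij (hg (ha.1.symm.trans hb.1))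

theorem theorem1 (n I : ℕ) (eig : Fin I → ℂ) (k : Fin I → ℕ) (v : Fin n → ℂ)
    (heig : Function.Injective eig)
    (hpos : ∀ i, 0 < k i)
    (hsum : ∑ i, k i = n)
    (hmult : ∀ i, (Finset.univ.filter (fun j => v j = eig i)).card = k i) :
    ∃ d : ℕ, HasComplexDim (similarityClass (Matrix.diagonal v)) d ∧
      (d : ℤ) = (n : ℤ) ^ 2 - ∑ i, (k i : ℤ) ^ 2 := by
  refine ⟨_, hasComplexDim_similarityClass_diagonal v, ?_⟩
  -- As the multiplicities add up to `n`, every diagonal entry is one of the `eig i`.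
  have hcover : ∀ j, ∃ i, v j = eig i := by
    have hdisj : (Finset.univ.biUnion fun i => Finset.univ.filter fun j => v j = eig i).card
        = Fintype.card (Fin n) := by
      rw [Finset.card_biUnion, Fintype.card_fin]
      · simp_rw [hmult, hsum]
      · intro i _ j _ hij
        rw [Function.onFun, Finset.disjoint_left]
        intro a ha hb
        simp only [Finset.mem_filter, Finset.mem_univ, true_and] at ha hb
        exact hij (heig (ha.symm.trans hb))
    intro j
    have hj := Finset.mem_univ j
    rw [← (Finset.card_eq_iff_eq_univ _).1 hdisj] at hj
    simpa using hj
  have h := Matrix.finrank_ker_commutantProj_add v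
  rw [Finset.card_filter_eq_eq_sum_sq heig hcover] at h
  simp_rw [hmult] at h
  rw [eq_sub_iff_add_eq]
  exact_mod_cast h
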